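/- Let $d\ge 2$ be an integer, $q\ge 2$ a real number, and let $\mathcal H_A,\mathcal H_B$ be $d$-dimensional complex Hilbert spaces. For a pure state $|\Phi\rangle\in\mathcal H_A\otimes\mathcal H_B$ with reduced state $\rho_A=\operatorname{tr}_B|\Phi\rangle\langle\Phi|$ put $$\mathcal C^t_q(|\Phi\rangle)=\frac1\mu\Big[1-\operatorname{tr}\rho_A^q+\operatorname{tr}(I-\rho_A)-\operatorname{tr}(I-\rho_A)^q\Big],\qquad \mu=d-d^{1-q}\big(1+(d-1)^q\big),$$ and for a density matrix $\rho$ on $\mathcal H_A\otimes\mathcal H_B$ let $$\mathcal C^t_q(\rho)=\inf\sum_i p_i\,\mathcal C^t_q(|\Phi_i\rangle),$$ the infimum being over all finite decompositions $\rho=\sum_i p_i|\Phi_i\rangle\langle\Phi_i|$ into pure states with $p_i\ge 0$, $\sum_i p_i=1$. Then $\mathcal C^t_q$ is a well-defined measure of bipartite entanglement. That is, for every density matrix the infimum is over a non-empty set bounded below; $\mathcal C^t_q(|\Phi\rangle\langle\Phi|)=\mathcal C^t_q(|\Phi\rangle)$ for every pure state; and, for every density matrix $\rho$ on $\mathcal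 H_A\otimes\mathcal H_B$: 1. (E1) $\mathcal C^t_q(\rho)\ge 0$, with equality if and only if $\rho$ is separable, i.e. a finite convex combination of product states $\sigma\otimes\tau$; 2. (E2) $\mathcal C^t_q\big((U\otimes V)\rho(U\otimes V)^\dagger\big)=\mathcal C^t_q(\rho)$ for all unitaries $U$ on $\mathcal H_A$ and $V$ on $\mathcal H_B$; 3. (E3) $\sum_i p_i\,\mathcal C^t_q(\rho_i)\le\mathcal C^t_q(\rho)$, where $p_i=\operatorname{tr}(A_i\rho A_i^\dagger)$ and $\rho_i=A_i\rho A_i^\dagger/p_i$ (terms with $p_i=0$ being $0$), for the Kraus operators $(A_i)$ of every finite-round local-operations-and-classical-communication (LOCC) protocol whose outputs are again $d\otimes d$ systems; and, more generally, the same inequality with $A_i\rho A_i^\dagger$ replaced by $M_k(\rho)=\sum_{i\in S_k}A_i\rho A_i^\dagger$, for every partition $(S_k)$ of the outcomes; 4. (E4) $\mathcal C^t_q\big(\sum_i p_i\rho_i\big)\le\sum_i p_i\,\mathcal C^t_q(\rho_i)$ for all finite convex combinations of density matrices $\rho_i$ on $\mathcal H_A\otimes\mathcal H_B$; 5. (E5)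 $\mathcal C^t_q(\Lambda(\rho))\le\mathcal C^t_q(\rho)$ for every LOCC map $\Lambda(\rho)=\sum_i A_i\rho A_i^\dagger$, where $(A_i)$ are the Kraus operators of a protocol as in (E3). In an LOCC protocol the parties act in turn, any finite number of times, with local measurements (finite families of Kraus operators $K_i$ with $\sum_iK_i^\dagger K_i=I$) which may depend on all earlier outcomes and may change the local dimensions in between. -/

import Mathlib

open scoped Matrix Kronecker ComplexOrder

namespace Entanglement

noncomputable section

/-- Density matrices: positive semidefinite matrices of trace one. -/
def IsDensity {ι : Type} [Fintype ι] (ρ : Matrix ι ι ℂ) : Prop :=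
  ρ.PosSemidef ∧ ρ.trace = 1

/-- Unit vectors, the representatives of pure states. -/
def IsUnitVec {ι : Type} [Fintype ι] (ψ : ι → ℂ) : Prop :=
  star ψ ⬝ᵥ ψ = 1

/-- The operator `|ψ⟩⟨ψ|`. -/
def ketbra {ι : Type} (ψ : ι → ℂ) : Matrix ι ι ℂ :=
  Matrix.vecMulVec ψ (star ψ)

/-- The partial trace over the second tensor factor. -/
def partialTraceB {a b : ℕ} (X : Matrix (Fin a × Fin b) (Fin a × Fin b) ℂ) :
    Matrix (Fin a) (Fin a) ℂ :=
  Matrix.of fun i j => ∑ k, X (i, k) (j, k)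

/-- A bipartite state is separable if it is a finite convex combination of product states. -/
def IsSeparable {a b : ℕ} (ρ : Matrix (Fin a × Fin b) (Fin a × Fin b) ℂ) : Prop :=
  ∃ (n : ℕ) (p : Fin n → ℝ) (σ : Fin n → Matrix (Fin a) (Fin a) ℂ)
    (τ : Fin n → Matrix (Fin b) (Fin b) ℂ),
    (∀ i, 0 ≤ p i) ∧ ∑ i, p i = 1 ∧ (∀ i, IsDensity (σ i)) ∧ (∀ i, IsDensity (τ i)) ∧
      ρ = ∑ i, (p i : ℂ) • (σ i ⊗ₖ τ i)

/-- `tr (X ^ q)` for a positive semidefinite matrix `X` and a real exponent `q`; the power is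
taken in the functional calculus of Hermitian matrices. -/
def trPow {ι : Type} [Fintype ι] [DecidableEq ι] (q : ℝ) (X : Matrix ι ι ℂ) : ℝ :=
  (cfc (fun x : ℝ => x ^ q) X).trace.re

/-- `F(ρ) = 1 - tr ρ^q + tr (I - ρ) - tr (I - ρ)^q`. -/
def totalF {ι : Type} [Fintype ι] [DecidableEq ι] (q : ℝ) (ρ : Matrix ι ι ℂ) : ℝ :=
  1 - trPow q ρ + (1 - ρ).trace.re - trPow q (1 - ρ)

/-- The normalization factor `μ = d - d^(1-q) (1 + (d-1)^q)`. -/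
def normFactor (d : ℕ) (q : ℝ) : ℝ :=
  (d : ℝ) - (d : ℝ) ^ (1 - q) * (1 + ((d : ℝ) - 1) ^ q)

/-- The normalized total concurrence of the pure state `|ψ⟩` of a `d ⊗ d` system. -/
def pureConcurrence {d : ℕ} (q : ℝ) (ψ : Fin d × Fin d → ℂ) : ℝ :=
  (1 / normFactor d q) * totalF q (partialTraceB (ketbra ψ))

/-- The average values `∑ i, p i * C(ψ i)` over all finite pure-state decompositions
`ρ = ∑ i, p i |ψ i⟩⟨ψ i|`. -/
def ensembleAverages {d : ℕ} (q : ℝ) (ρ : Matrix (Fin d × Fin d) (Fin d × Fin d) ℂ) : Set ℝ :=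
  {x | ∃ (n : ℕ) (p : Fin n → ℝ) (ψ : Fin n → Fin d × Fin d → ℂ),
    (∀ i, 0 ≤ p i) ∧ ∑ i, p i = 1 ∧ (∀ i, IsUnitVec (ψ i)) ∧
      ρ = ∑ i, (p i : ℂ) • ketbra (ψ i) ∧ x = ∑ i, p i * pureConcurrence q (ψ i)}

/-- The convex-roof extension of the normalized total concurrence. -/
def concurrence {d : ℕ} (q : ℝ) (ρ : Matrix (Fin d × Fin d) (Fin d × Fin d) ℂ) : ℝ :=
  sInf (ensembleAverages q ρ)

/-- The families of Kraus operators of the finite-round LOCC protocols from an `a ⊗ b` system to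
an `a' ⊗ b'` system, one operator for each possible record of measurement outcomes.
Either nothing is done (`done`), or one of the parties performs a measurement with Kraus operators
`K i` on its own system, whose dimension may change (adding and discarding local ancillas is
included), announces the outcome `i`, and an LOCC protocol depending on `i` follows. -/
inductive IsLOCCKraus {a' b' : ℕ} : ∀ {a b : ℕ} {ι : Type},
    (ι → Matrix (Fin a' × Fin b') (Fin a × Fin b) ℂ) → Prop
  | done : IsLOCCKraus (fun _ : Unit => (1 : Matrix (Fin a' × Fin b') (Fin a' × Fin b') ℂ))
  | alice {a b n : ℕ} (dim : Fin n → ℕ) (K : ∀ i, Matrix (Fin (dim i)) (Fin a) ℂ)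
      (hK : ∑ i, (K i)ᴴ * K i = 1) {κ : Fin n → Type}
      (L : ∀ i, κ i → Matrix (Fin a' × Fin b') (Fin (dim i) × Fin b) ℂ)
      (hL : ∀ i, IsLOCCKraus (L i)) :
      IsLOCCKraus (fun x : Σ i, κ i =>
        L x.1 x.2 * (K x.1 ⊗ₖ (1 : Matrix (Fin b) (Fin b) ℂ)))
  | bob {a b n : ℕ} (dim : Fin n → ℕ) (K : ∀ i, Matrix (Fin (dim i)) (Fin b) ℂ)
      (hK : ∑ i, (K i)ᴴ * K i = 1) {κ : Fin n → Type}
      (L : ∀ i, κ i → Matrix (Fin a' × Fin b') (Fin a × Fin (dim i)) ℂ)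
      (hL : ∀ i, IsLOCCKraus (L i)) :
      IsLOCCKraus (fun x : Σ i, κ i =>
        L x.1 x.2 * ((1 : Matrix (Fin a) (Fin a) ℂ) ⊗ₖ K x.1))

open Classical in
/-- LOCC instruments: the outcome records of an LOCC protocol are sorted into classes `k`,
and only the class is kept. `M k` is the (unnormalized) map belonging to the class `k`. -/
def IsLOCCInstrument {a b a' b' : ℕ} {κ : Type}
    (M : κ → Matrix (Fin a × Fin b) (Fin a × Fin b) ℂ →
      Matrix (Fin a' × Fin b') (Fin a' × Fin b') ℂ) : Prop :=
  ∃ (ι : Type) (_ : Fintype ι) (A : ι → Matrix (Fin a' × Fin b') (Fin a × Fin b) ℂ) (f : ι → κ),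
    IsLOCCKraus A ∧ ∀ k X, M k X = ∑ i with f i = k, A i * X * (A i)ᴴ

/-- LOCC maps: `Λ(X) = ∑ i, A i X (A i)†` with the Kraus operators of an LOCC protocol. -/
def IsLOCCMap {a b a' b' : ℕ} (Λ : Matrix (Fin a × Fin b) (Fin a × Fin b) ℂ →
    Matrix (Fin a' × Fin b') (Fin a' × Fin b') ℂ) : Prop :=
  ∃ (ι : Type) (_ : Fintype ι) (A : ι → Matrix (Fin a' × Fin b') (Fin a × Fin b) ℂ),
    IsLOCCKraus A ∧ ∀ X, Λ X = ∑ i, A i * X * (A i)ᴴ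

/-- The requirements on an entanglement measure for `d ⊗ d` systems. -/
structure IsEntanglementMeasure {d : ℕ}
    (E : Matrix (Fin d × Fin d) (Fin d × Fin d) ℂ → ℝ) : Prop where
  nonneg : ∀ ρ, IsDensity ρ → 0 ≤ E ρ
  eq_zero_iff : ∀ ρ, IsDensity ρ → (E ρ = 0 ↔ IsSeparable ρ)
  local_unitary : ∀ ρ, IsDensity ρ →
    ∀ U ∈ Matrix.unitaryGroup (Fin d) ℂ, ∀ V ∈ Matrix.unitaryGroup (Fin d) ℂ,
      E ((U ⊗ₖ V) * ρ * (U ⊗ₖ V)ᴴ) = E ρ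
  /-- No increase on average over the outcomes of an LOCC protocol. -/
  average_kraus : ∀ ρ, IsDensity ρ → ∀ (ι : Type) [Fintype ι]
    (A : ι → Matrix (Fin d × Fin d) (Fin d × Fin d) ℂ), IsLOCCKraus A →
      ∑ i, (A i * ρ * (A i)ᴴ).trace.re *
        E ((((A i * ρ * (A i)ᴴ).trace.re⁻¹ : ℝ) : ℂ) • (A i * ρ * (A i)ᴴ)) ≤ E ρ
  /-- The same when the outcomes are coarse-grained. -/
  average_instrument : ∀ ρ, IsDensity ρ → ∀ (κ : Type) [Fintype κ]
    (M : κ → Matrix (Fin d × Fin d) (Fin d × Fin d) ℂ →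
      Matrix (Fin d × Fin d) (Fin d × Fin d) ℂ), IsLOCCInstrument M →
      ∑ k, (M k ρ).trace.re * E ((((M k ρ).trace.re⁻¹ : ℝ) : ℂ) • M k ρ) ≤ E ρ
  convex : ∀ (n : ℕ) (p : Fin n → ℝ)
    (ρ : Fin n → Matrix (Fin d × Fin d) (Fin d × Fin d) ℂ),
    (∀ i, 0 ≤ p i) → ∑ i, p i = 1 → (∀ i, IsDensity (ρ i)) →
      E (∑ i, (p i : ℂ) • ρ i) ≤ ∑ i, p i * E (ρ i)
  locc_map : ∀ ρ, IsDensity ρ → ∀ Λ : Matrix (Fin d × Fin d) (Fin d × Fin d) ℂ →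
    Matrix (Fin d × Fin d) (Fin d × Fin d) ℂ, IsLOCCMap Λ → E (Λ ρ) ≤ E ρ

end

end Entanglement

/-!
The total concurrence of a unit vector is `μ⁻¹ ∑ f(λᵢ)`, where `f(x) = 1 - x ^ q - (1 - x) ^ q` and
the `λᵢ` are the eigenvalues of the reduced state. Everything rests on three properties of `f` on
`[0, 1]`: it is concave, it vanishes at `0` and at `1`, and for `2 ≤ q` it is at least
`2 (x - x ^ 2)`.

*Monotonicity.* By Jensen's and Peierls' inequalities `X ↦ tr f(X)` is concave
(`sum_mul_traceFn_le`), so its extension `homF` to unnormalized states, homogeneous of degree one,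
is superadditive (`sum_homF_le`). A measurement of Bob splits the reduced state of Alice into the
sum of the unnormalized reduced states of the outcomes, hence does not increase the average of
`homF`. As `A Aᴴ` and `Aᴴ A` have the same nonzero spectrum and `f 0 = 0`, the two reduced states
give the same value, in all dimensions, and a measurement of Alice is covered by the same argument.
Induction over the protocol gives `IsLOCCKraus.sum_vecF_le` for vectors. For mixed states, apply the
Kraus operators to the vectors of a nearly optimal decomposition: the results decompose all outcome
states, coarse-grained or not (`sum_trace_mul_concurrence_le`). Monotonicity under LOCC maps and
invariance under local unitaries are special cases. It is convenient throughout to absorb the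
weights of an ensemble into its vectors and to work with `vecF`, the concurrence of an unnormalized
vector without the factor `μ⁻¹`.

*Faithfulness.* `f 0 = f 1 = 0` makes the concurrence vanish on product vectors, hence on separable
states. Conversely the lower bound for `f` bounds the concurrence of a unit vector below by
a multiple of the sum `minorSq` of the squared `2 × 2` minors of its coefficient matrix, a
continuous function that vanishes only on product vectors. The pairs `(|ψ⟩⟨ψ|, minorSq ψ)` form a
compact set, whose convex hull is compact by Carathéodory's theorem. If the concurrence of `ρ`
vanishes, then `(ρ, 0)` is a limit of points of this hull, so it lies in it, and this exhibits `ρ`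
as a mixture of product vectors.
-/

namespace Entanglement

noncomputable section

/-! ### Trace functions of Hermitian matrices -/

/-- `tr f(X)`, with `f(X)` taken in the functional calculus of Hermitian matrices. -/
def traceFn {n : Type} [Fintype n] [DecidableEq n] (f : ℝ → ℝ) (X : Matrix n n ℂ) : ℝ :=
  (cfc f X).trace.re

section TraceFunctions

variable {n : Type} [Fintype n] [DecidableEq n]

theorem traceFn_eq_sum {X : Matrix n n ℂ} (hX : X.IsHermitian) (f : ℝ → ℝ) :
    traceFn f X = ∑ i, f (hX.eigenvalues i) := by
  rw [traceFn, hX.cfc_eq, Matrix.IsHermitian.cfc, Unitary.conjStarAlgAut_apply,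
    Matrix.trace_mul_comm, ← mul_assoc]
  simp [Matrix.trace_diagonal]

theorem trace_re_eq_sum {X : Matrix n n ℂ} (hX : X.IsHermitian) :
    X.trace.re = ∑ i, hX.eigenvalues i := by
  simp [hX.trace_eq_sum_eigenvalues]

theorem sum_normSq_col_of_unitary {W : Matrix n n ℂ} (hW : star W * W = 1) (j : n) :
    ∑ k, Complex.normSq (W k j) = 1 := by
  have h := congrFun (congrFun hW j) j
  rw [Matrix.mul_apply, Matrix.one_apply_eq] at h
  have h2 := congrArg Complex.re h
  simpa [Matrix.star_apply, Complex.normSq_apply, Complex.mul_re] using h2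

theorem sum_normSq_row_of_unitary {W : Matrix n n ℂ} (hW : W * star W = 1) (k : n) :
    ∑ j, Complex.normSq (W k j) = 1 := by
  have h := congrFun (congrFun hW k) k
  rw [Matrix.mul_apply, Matrix.one_apply_eq] at h
  have h2 := congrArg Complex.re h
  simpa [Matrix.star_apply, Complex.normSq_apply, Complex.mul_re] using h2

/-- In any orthonormal basis (the columns of `U`), the diagonal of a Hermitian matrix is the image
of its eigenvalues under a doubly stochastic matrix. -/
theorem exists_doublyStochastic_diag {Y : Matrix n n ℂ} (hY : Y.IsHermitian)
    (U : Matrix.unitaryGroup n ℂ) :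
    ∃ P : n → n → ℝ, (∀ j k, 0 ≤ P j k) ∧ (∀ j, ∑ k, P j k = 1) ∧ (∀ k, ∑ j, P j k = 1) ∧
      ∀ j, ((star (U : Matrix n n ℂ) * Y * U) j j).re = ∑ k, P j k * hY.eigenvalues k := by
  set V := hY.eigenvectorUnitary with hV
  set W : Matrix.unitaryGroup n ℂ := star V * U with hWdef
  refine ⟨fun j k => Complex.normSq ((W : Matrix n n ℂ) k j), fun j k => Complex.normSq_nonneg _,
    fun j => sum_normSq_col_of_unitary (Unitary.coe_star_mul_self W) j,
    fun k => sum_normSq_row_of_unitary (Unitary.coe_mul_star_self W) k, fun j => ?_⟩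
  have key : star (U : Matrix n n ℂ) * Y * U =
      star (W : Matrix n n ℂ) * (Matrix.diagonal (fun i => (hY.eigenvalues i : ℂ)) :
        Matrix n n ℂ) * (W : Matrix n n ℂ) := by
    conv_lhs => rw [hY.spectral_theorem, Unitary.conjStarAlgAut_apply]
    simp [hWdef, mul_assoc, hV, Function.comp_def]
  rw [key, Matrix.mul_apply, Complex.re_sum]
  refine Finset.sum_congr rfl fun k _ => ?_
  rw [Matrix.mul_diagonal, Matrix.star_apply]
  simp [Complex.normSq_apply, Complex.mul_re, Complex.mul_im]
  ring

/-- Concavity of `X ↦ tr f(X)` for a concave `f`: in an eigenbasis of the convex combination,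
Jensen's inequality is used once for the weights `w` and once (Peierls) for each `Y i`. -/
theorem sum_mul_traceFn_le {ι : Type} [Fintype ι] {s : Set ℝ} {f : ℝ → ℝ}
    (hf : ConcaveOn ℝ s f) (w : ι → ℝ) (hw : ∀ i, 0 ≤ w i) (hw1 : ∑ i, w i = 1)
    (Y : ι → Matrix n n ℂ) (hY : ∀ i, (Y i).IsHermitian)
    (hs : ∀ i j, (hY i).eigenvalues j ∈ s) :
    ∑ i, w i * traceFn f (Y i) ≤ traceFn f (∑ i, (w i : ℂ) • Y i) := by
  have hX : (∑ i, (w i : ℂ) • Y i).IsHermitian := by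
    refine isSelfAdjoint_sum _ fun i _ => ?_
    exact IsSelfAdjoint.smul (Complex.conj_ofReal _) (hY i)
  rw [traceFn_eq_sum hX]
  choose P hP0 hP1 hP2 hP using fun i =>
    exists_doublyStochastic_diag (hY i) hX.eigenvectorUnitary
  have hmem : ∀ i j, ∑ k, P i j k * (hY i).eigenvalues k ∈ s := fun i j =>
    hf.1.sum_mem (fun k _ => hP0 i j k) (hP1 i j) fun k _ => hs i k
  have heig : ∀ j, hX.eigenvalues j = ∑ i, w i * ∑ k, P i j k * (hY i).eigenvalues k := by
    intro j
    have h := hX.conjStarAlgAut_star_eigenvectorUnitary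
    rw [Unitary.conjStarAlgAut_star_apply] at h
    have h2 := congrArg Complex.re (congrFun (congrFun h j) j)
    rw [Matrix.diagonal_apply_eq] at h2
    simp only [Function.comp_apply, Complex.coe_algebraMap,
      Complex.ofReal_re] at h2
    rw [← h2, Finset.mul_sum, Finset.sum_mul, Matrix.sum_apply, Complex.re_sum]
    refine Finset.sum_congr rfl fun i _ => ?_
    rw [← hP i j, Matrix.mul_smul, Matrix.smul_mul, Matrix.smul_apply, smul_eq_mul,
      Complex.re_ofReal_mul]
  calc ∑ i, w i * traceFn f (Y i)
      = ∑ j, ∑ i, w i * ∑ k, P i j k * f ((hY i).eigenvalues k) := by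
        rw [Finset.sum_comm]
        refine Finset.sum_congr rfl fun i _ => ?_
        rw [← Finset.mul_sum, Finset.sum_comm, traceFn_eq_sum (hY i)]
        congr 1
        refine Finset.sum_congr rfl fun k _ => ?_
        rw [← Finset.sum_mul, hP2, one_mul]
    _ ≤ ∑ j, ∑ i, w i * f (∑ k, P i j k * (hY i).eigenvalues k) := by
        refine Finset.sum_le_sum fun j _ => Finset.sum_le_sum fun i _ =>
          mul_le_mul_of_nonneg_left ?_ (hw i)
        exact hf.le_map_sum (fun k _ => hP0 i j k) (hP1 i j) fun k _ => hs i k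
    _ ≤ ∑ j, f (hX.eigenvalues j) := by
        refine Finset.sum_le_sum fun j _ => ?_
        rw [heig]
        exact hf.le_map_sum (fun i _ => hw i) hw1 fun i _ => hmem i j

theorem traceFn_eq_sum_roots {X : Matrix n n ℂ} (hX : X.IsHermitian) (f : ℝ → ℝ) :
    traceFn f X = (X.charpoly.roots.map fun z => f z.re).sum := by
  rw [traceFn_eq_sum hX, hX.roots_charpoly_eq_eigenvalues, Multiset.map_map]
  rfl

/-- `A Aᴴ` and `Aᴴ A` have the same nonzero eigenvalues: their characteristic polynomials differ by
a power of the variable, whose roots contribute `f 0 = 0`. -/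
theorem traceFn_mul_conjTranspose_comm {m : Type} [Fintype m] [DecidableEq m] {f : ℝ → ℝ}
    (hf : f 0 = 0) (A : Matrix m n ℂ) : traceFn f (A * Aᴴ) = traceFn f (Aᴴ * A) := by
  rw [traceFn_eq_sum_roots (Matrix.isHermitian_mul_conjTranspose_self A),
    traceFn_eq_sum_roots (Matrix.isHermitian_conjTranspose_mul_self A)]
  have h := congrArg (fun p => (p.roots.map fun z => f z.re).sum) (Matrix.charpoly_mul_comm' A Aᴴ)
  rw [Polynomial.roots_mul (mul_ne_zero (pow_ne_zero _ Polynomial.X_ne_zero)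
    (Matrix.charpoly_monic _).ne_zero), Polynomial.roots_mul (mul_ne_zero
    (pow_ne_zero _ Polynomial.X_ne_zero) (Matrix.charpoly_monic _).ne_zero)] at h
  simpa [hf, Multiset.map_nsmul, Multiset.sum_nsmul] using h

theorem eigenvalues_mem_Icc {X : Matrix n n ℂ} (hX : X.PosSemidef) (ht : X.trace.re ≤ 1) (i : n) :
    hX.isHermitian.eigenvalues i ∈ Set.Icc (0 : ℝ) 1 := by
  refine ⟨hX.eigenvalues_nonneg i, le_trans ?_ ht⟩
  rw [trace_re_eq_sum hX.isHermitian]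
  exact Finset.single_le_sum (fun j _ => hX.eigenvalues_nonneg j) (Finset.mem_univ i)

end TraceFunctions

/-! ### The concave function `1 - x ^ q - (1 - x) ^ q` -/

/-- The function `1 - x ^ q - (1 - x) ^ q`, whose sum over the spectrum of a state is `totalF`. -/
def entFn (q x : ℝ) : ℝ := 1 - x ^ q - (1 - x) ^ q

theorem entFn_zero {q : ℝ} (hq : 2 ≤ q) : entFn q 0 = 0 := by
  simp [entFn, Real.zero_rpow (by linarith : q ≠ 0)]

theorem entFn_one {q : ℝ} (hq : 2 ≤ q) : entFn q 1 = 0 := by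
  simp [entFn, Real.zero_rpow (by linarith : q ≠ 0)]

theorem concaveOn_entFn {q : ℝ} (hq : 2 ≤ q) : ConcaveOn ℝ (Set.Icc 0 1) (entFn q) := by
  have hc := convexOn_rpow (p := q) (by linarith)
  refine ⟨convex_Icc 0 1, fun x hx y hy a b ha hb hab => ?_⟩
  have h1 := hc.2 (x := x) hx.1 (y := y) hy.1 ha hb hab
  have h2 := hc.2 (x := 1 - x) (sub_nonneg.2 hx.2) (y := 1 - y) (sub_nonneg.2 hy.2) ha hb hab
  simp only [smul_eq_mul, entFn] at h1 h2 ⊢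
  have e : 1 - (a * x + b * y) = a * (1 - x) + b * (1 - y) := by linear_combination -hab
  rw [e]
  linear_combination h1 + h2 + hab

/-- On `[0, 1]` the powers `x ^ q` decrease in `q`, so the case `q = 2` is a lower bound. -/
theorem two_mul_le_entFn {q : ℝ} (hq : 2 ≤ q) {x : ℝ} (hx : x ∈ Set.Icc (0 : ℝ) 1) :
    2 * (x - x ^ 2) ≤ entFn q x := by
  have h1 := Real.rpow_le_rpow_of_exponent_ge' hx.1 hx.2 (by norm_num : (0 : ℝ) ≤ 2) hq
  have h2 := Real.rpow_le_rpow_of_exponent_ge' (sub_nonneg.2 hx.2) (sub_le_self 1 hx.1)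
    (by norm_num : (0 : ℝ) ≤ 2) hq
  rw [Real.rpow_two] at h1 h2
  unfold entFn
  nlinarith

theorem entFn_nonneg {q : ℝ} (hq : 2 ≤ q) {x : ℝ} (hx : x ∈ Set.Icc (0 : ℝ) 1) :
    0 ≤ entFn q x :=
  le_trans (by nlinarith [hx.1, hx.2]) (two_mul_le_entFn hq hx)

theorem normFactor_pos {d : ℕ} (hd : 2 ≤ d) {q : ℝ} (hq : 2 ≤ q) : 0 < normFactor d q := by
  have hd' : (2 : ℝ) ≤ d := by exact_mod_cast hd
  have hd0 : (0 : ℝ) < d := by linarith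
  have hx : (d : ℝ)⁻¹ < 1 := inv_lt_one_of_one_lt₀ (by linarith)
  have hx0 : 0 < (d : ℝ)⁻¹ := inv_pos.2 hd0
  -- `normFactor d q` is `totalF` of the maximally mixed state
  have e : normFactor d q = d * entFn q (d : ℝ)⁻¹ := by
    have e1 : 1 - (d : ℝ)⁻¹ = (d - 1) / d := by field_simp
    rw [normFactor, entFn, e1, Real.div_rpow (by linarith) hd0.le, Real.inv_rpow hd0.le,
      Real.rpow_sub hd0, Real.rpow_one]
    field_simp
    ring
  rw [e]
  have := two_mul_le_entFn hq (x := (d : ℝ)⁻¹) ⟨hx0.le, hx.le⟩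
  refine mul_pos hd0 (lt_of_lt_of_le ?_ this)
  nlinarith

/-! ### The homogeneous extension -/

section Homogeneous

section Trace

variable {n : Type} [Fintype n]

theorem trace_re_nonneg {X : Matrix n n ℂ} (hX : X.PosSemidef) : 0 ≤ X.trace.re :=
  (Complex.le_def.1 hX.trace_nonneg).1

theorem posSemidef_real_smul {m : Type} {X : Matrix m m ℂ} (hX : X.PosSemidef) {c : ℝ}
    (hc : 0 ≤ c) :
    ((c : ℂ) • X).PosSemidef :=
  hX.smul (Complex.zero_le_real.2 hc)

theorem trace_eq_ofReal {X : Matrix n n ℂ} (hX : X.PosSemidef) : X.trace = (X.trace.re : ℂ) :=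
  Complex.ext rfl (by simpa using (Complex.le_def.1 hX.trace_nonneg).2.symm)

theorem trace_re_normalized_le (X : Matrix n n ℂ) :
    (((X.trace.re⁻¹ : ℝ) : ℂ) • X).trace.re ≤ 1 := by
  rw [Matrix.trace_smul, smul_eq_mul, Complex.re_ofReal_mul]
  exact inv_mul_le_one

theorem eq_zero_of_trace_re {X : Matrix n n ℂ} (hX : X.PosSemidef) (h : X.trace.re = 0) :
    X = 0 := by
  rw [← hX.trace_eq_zero_iff, trace_eq_ofReal hX, h, Complex.ofReal_zero]

end Trace

variable {n : Type} [Fintype n] [DecidableEq n]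

/-- The power of `1 - X` as a function of `X`; continuity is automatic on a finite spectrum. -/
theorem trPow_one_sub {X : Matrix n n ℂ} (hX : X.IsHermitian) {q : ℝ} :
    trPow q (1 - X) = traceFn (fun x => (1 - x) ^ q) X := by
  have hX' : IsSelfAdjoint X := hX
  have e : (1 : Matrix n n ℂ) - X = cfc (fun x : ℝ => 1 - x) X := by
    rw [cfc_sub (fun _ => (1 : ℝ)) (fun x => x) X, cfc_const_one ℝ X, cfc_id' ℝ X]
  have hfin : ∀ g : ℝ → ℝ, ∀ s : Set ℝ, s.Finite → ContinuousOn g s := fun g s hs =>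
    hs.continuousOn g
  rw [trPow, e, ← cfc_comp' (fun x : ℝ => x ^ q) (fun x : ℝ => 1 - x) X
    (hfin _ _ ((Matrix.finite_real_spectrum).image _)) (hfin _ _ Matrix.finite_real_spectrum)]
  rfl

theorem totalF_eq_traceFn {X : Matrix n n ℂ} (hX : X.IsHermitian) (ht : X.trace = 1) (q : ℝ) :
    totalF q X = traceFn (entFn q) X := by
  have h1 : trPow q X = ∑ i, hX.eigenvalues i ^ q := traceFn_eq_sum hX _
  rw [totalF, h1, trPow_one_sub hX, traceFn_eq_sum hX, traceFn_eq_sum hX, Matrix.trace_sub, ht]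
  simp [entFn, Finset.sum_sub_distrib]

/-- The function `tr (X)·tr f(X / tr X)` for `f = entFn q`: the extension of `totalF` to
unnormalized states that is homogeneous of degree one. It vanishes where `tr X = 0`. -/
def homF (q : ℝ) (X : Matrix n n ℂ) : ℝ :=
  X.trace.re * traceFn (entFn q) (((X.trace.re⁻¹ : ℝ) : ℂ) • X)

theorem homF_of_trace_one {X : Matrix n n ℂ} (hX : X.IsHermitian) (ht : X.trace = 1) (q : ℝ) :
    homF q X = totalF q X := by
  simp [homF, ht, totalF_eq_traceFn hX ht]

theorem homF_smul (q : ℝ) (c : ℝ) (X : Matrix n n ℂ) : homF q ((c : ℂ) • X) = c * homF q X := by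
  rcases eq_or_ne c 0 with rfl | hc
  · simp [homF]
  · simp only [homF, Matrix.trace_smul, smul_eq_mul, Complex.re_ofReal_mul, smul_smul,
      ← Complex.ofReal_mul]
    rw [mul_inv, mul_right_comm c⁻¹, inv_mul_cancel₀ hc, one_mul, mul_assoc]

theorem homF_nonneg {q : ℝ} (hq : 2 ≤ q) {X : Matrix n n ℂ} (hX : X.PosSemidef) :
    0 ≤ homF q X := by
  have h := posSemidef_real_smul hX (inv_nonneg.2 (trace_re_nonneg hX))
  refine mul_nonneg (trace_re_nonneg hX) ?_
  rw [traceFn_eq_sum h.isHermitian]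
  exact Finset.sum_nonneg fun i _ =>
    entFn_nonneg hq (eigenvalues_mem_Icc h (trace_re_normalized_le X) i)

/-- Concavity and homogeneity of `homF` make it superadditive. -/
theorem sum_homF_le {q : ℝ} (hq : 2 ≤ q) {ι : Type} [Fintype ι] (X : ι → Matrix n n ℂ)
    (hX : ∀ i, (X i).PosSemidef) : ∑ i, homF q (X i) ≤ homF q (∑ i, X i) := by
  have hS : (∑ i, X i).PosSemidef := Matrix.posSemidef_sum _ fun i _ => hX i
  have htr : (∑ i, X i).trace.re = ∑ i, (X i).trace.re := by
    rw [Matrix.trace_sum, Complex.re_sum]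
  rcases eq_or_ne (∑ i, X i).trace.re 0 with h0 | h0
  · have hz : ∀ i, (X i).trace.re = 0 := fun i =>
      (Finset.sum_eq_zero_iff_of_nonneg fun i _ => trace_re_nonneg (hX i)).1 (htr.symm.trans h0) i
        (Finset.mem_univ i)
    simp [homF, hz]
  · set t := (∑ i, X i).trace.re with ht
    have htp : 0 < t := lt_of_le_of_ne (trace_re_nonneg hS) (Ne.symm h0)
    have hY := fun i => posSemidef_real_smul (hX i) (inv_nonneg.2 (trace_re_nonneg (hX i)))
    have key := sum_mul_traceFn_le (concaveOn_entFn hq) (fun i => (X i).trace.re / t)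
      (fun i => div_nonneg (trace_re_nonneg (hX i)) htp.le)
      (by rw [← Finset.sum_div, ← htr, div_self h0])
      (fun i => (((X i).trace.re⁻¹ : ℝ) : ℂ) • X i) (fun i => (hY i).isHermitian)
      fun i j => eigenvalues_mem_Icc (hY i) (trace_re_normalized_le (X i)) j
    have hsum : ∑ i, (((X i).trace.re / t : ℝ) : ℂ) • ((((X i).trace.re⁻¹ : ℝ) : ℂ) • X i) =
        ((t⁻¹ : ℝ) : ℂ) • ∑ i, X i := by
      rw [Finset.smul_sum]
      refine Finset.sum_congr rfl fun i _ => ?_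
      rcases eq_or_ne (X i).trace.re 0 with hi | hi
      · simp [eq_zero_of_trace_re (hX i) hi]
      · rw [smul_smul, ← Complex.ofReal_mul]
        congr 2
        field_simp
    rw [hsum] at key
    have := mul_le_mul_of_nonneg_left key htp.le
    rw [Finset.mul_sum] at this
    refine le_trans (le_of_eq (Finset.sum_congr rfl fun i _ => ?_)) this
    rw [homF]
    field_simp

theorem homF_mul_conjTranspose_comm {q : ℝ} (hq : 2 ≤ q) {m : Type} [Fintype m] [DecidableEq m]
    (A : Matrix m n ℂ) : homF q (A * Aᴴ) = homF q (Aᴴ * A) := by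
  have hc : 0 ≤ (A * Aᴴ).trace.re⁻¹ :=
    inv_nonneg.2 (trace_re_nonneg (Matrix.posSemidef_self_mul_conjTranspose A))
  -- the scalar is absorbed into `A` as a square root
  have e : (((A * Aᴴ).trace.re⁻¹ : ℝ) : ℂ) =
      ((√(A * Aᴴ).trace.re⁻¹ : ℝ) : ℂ) * ((√(A * Aᴴ).trace.re⁻¹ : ℝ) : ℂ) := by
    rw [← Complex.ofReal_mul, Real.mul_self_sqrt hc]
  have h := traceFn_mul_conjTranspose_comm (entFn_zero hq)
    (((√(A * Aᴴ).trace.re⁻¹ : ℝ) : ℂ) • A)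
  simp only [Matrix.conjTranspose_smul, Complex.star_def, Complex.conj_ofReal, Matrix.smul_mul,
    Matrix.mul_smul, smul_smul, ← e] at h
  rw [homF, homF, h, Matrix.trace_mul_comm]

end Homogeneous

/-! ### Bipartite vectors and their coefficient matrices -/

/-- The matrix of coefficients of a bipartite vector. -/
def coeffMat {a b : ℕ} (ψ : Fin a × Fin b → ℂ) : Matrix (Fin a) (Fin b) ℂ :=
  Matrix.of fun i k => ψ (i, k)

/-- The unnormalized total concurrence of a possibly unnormalized vector, homogeneous of degree
two in the vector. -/
def vecF {a b : ℕ} (q : ℝ) (ψ : Fin a × Fin b → ℂ) : ℝ :=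
  homF q (partialTraceB (ketbra ψ))

section Vectors

variable {a b : ℕ}

theorem partialTraceB_ketbra (ψ : Fin a × Fin b → ℂ) :
    partialTraceB (ketbra ψ) = coeffMat ψ * (coeffMat ψ)ᴴ := by
  ext i j
  simp [partialTraceB, ketbra, coeffMat, Matrix.mul_apply, Matrix.vecMulVec_apply]

theorem posSemidef_partialTraceB_ketbra (ψ : Fin a × Fin b → ℂ) :
    (partialTraceB (ketbra ψ)).PosSemidef := by
  rw [partialTraceB_ketbra]
  exact Matrix.posSemidef_self_mul_conjTranspose _

theorem posSemidef_ketbra {ι : Type} [Fintype ι] (ψ : ι → ℂ) : (ketbra ψ).PosSemidef :=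
  Matrix.posSemidef_vecMulVec_self_star ψ

theorem trace_ketbra {ι : Type} [Fintype ι] (ψ : ι → ℂ) :
    (ketbra ψ).trace = star ψ ⬝ᵥ ψ := by
  rw [ketbra, Matrix.trace_vecMulVec, dotProduct_comm]

theorem ketbra_smul {ι : Type} (c : ℂ) (ψ : ι → ℂ) :
    ketbra (c • ψ) = ((Complex.normSq c : ℝ) : ℂ) • ketbra ψ := by
  ext i j
  simp only [ketbra, Matrix.vecMulVec_apply, Matrix.smul_apply, Pi.smul_apply, Pi.star_apply,
    smul_eq_mul, star_mul, Complex.normSq_eq_conj_mul_self, Complex.star_def]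
  ring

theorem ketbra_sqrt_smul {ι : Type} {c : ℝ} (hc : 0 ≤ c) (ψ : ι → ℂ) :
    ketbra (((√c : ℝ) : ℂ) • ψ) = (c : ℂ) • ketbra ψ := by
  rw [ketbra_smul, Complex.normSq_ofReal, Real.mul_self_sqrt hc]

theorem mul_ketbra_mul {ι κ : Type} [Fintype ι] (A : Matrix κ ι ℂ) (ψ : ι → ℂ) :
    A * ketbra ψ * Aᴴ = ketbra (A *ᵥ ψ) := by
  rw [ketbra, Matrix.mul_vecMulVec, Matrix.vecMulVec_mul, ketbra, Matrix.star_mulVec]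

theorem trace_partialTraceB (X : Matrix (Fin a × Fin b) (Fin a × Fin b) ℂ) :
    (partialTraceB X).trace = X.trace := by
  simp [partialTraceB, Matrix.trace, Fintype.sum_prod_type]

theorem partialTraceB_smul (c : ℂ) (X : Matrix (Fin a × Fin b) (Fin a × Fin b) ℂ) :
    partialTraceB (c • X) = c • partialTraceB X := by
  ext i j
  simp [partialTraceB, Finset.mul_sum]

theorem vecF_nonneg {q : ℝ} (hq : 2 ≤ q) (ψ : Fin a × Fin b → ℂ) : 0 ≤ vecF q ψ :=
  homF_nonneg hq (posSemidef_partialTraceB_ketbra ψ)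

theorem vecF_smul (q : ℝ) (c : ℂ) (ψ : Fin a × Fin b → ℂ) :
    vecF q (c • ψ) = Complex.normSq c * vecF q ψ := by
  rw [vecF, ketbra_smul, partialTraceB_smul, homF_smul, vecF]

theorem vecF_sqrt_smul (q : ℝ) {c : ℝ} (hc : 0 ≤ c) (ψ : Fin a × Fin b → ℂ) :
    vecF q (((√c : ℝ) : ℂ) • ψ) = c * vecF q ψ := by
  rw [vecF_smul, Complex.normSq_ofReal, Real.mul_self_sqrt hc]

theorem pureConcurrence_eq {d : ℕ} (q : ℝ) {ψ : Fin d × Fin d → ℂ} (hψ : IsUnitVec ψ) :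
    pureConcurrence q ψ = vecF q ψ / normFactor d q := by
  rw [pureConcurrence, vecF, homF_of_trace_one (posSemidef_partialTraceB_ketbra ψ).isHermitian]
  · ring
  · rw [trace_partialTraceB, trace_ketbra, hψ]

/-- `homF` vanishes on `|x⟩⟨x|`, whose nonzero spectrum is that of a `1 × 1` matrix. -/
theorem homF_ketbra {q : ℝ} (hq : 2 ≤ q) {n : Type} [Fintype n] [DecidableEq n] (x : n → ℂ) :
    homF q (ketbra x) = 0 := by
  have e : ketbra x = Matrix.replicateCol Unit x * (Matrix.replicateCol Unit x)ᴴ := by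
    rw [ketbra, Matrix.vecMulVec_eq Unit]
    rfl
  rw [e, homF_mul_conjTranspose_comm hq]
  set Z := (Matrix.replicateCol Unit x)ᴴ * Matrix.replicateCol Unit x with hZ
  have hpsd : Z.PosSemidef := Matrix.posSemidef_conjTranspose_mul_self _
  rcases eq_or_ne Z.trace.re 0 with h0 | h0
  · simp [homF, h0]
  · have h1 : ((Z.trace.re⁻¹ : ℝ) : ℂ) • Z = 1 := by
      ext i j
      have hz : Z i j = (Z.trace.re : ℂ) := by
        rw [← trace_eq_ofReal hpsd, Matrix.trace]
        simp
      rw [Matrix.smul_apply, hz, smul_eq_mul, ← Complex.ofReal_mul, inv_mul_cancel₀ h0]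
      simp
    have h2 : cfc (entFn q) (1 : Matrix Unit Unit ℂ) = 0 := by
      simp [← map_one (algebraMap ℝ (Matrix Unit Unit ℂ)), -map_one, cfc_algebraMap, entFn_one hq]
    rw [homF, h1, traceFn, h2]
    simp

/-- The product vector `x ⊗ y`. -/
def prodVec (x : Fin a → ℂ) (y : Fin b → ℂ) : Fin a × Fin b → ℂ := fun i => x i.1 * y i.2

theorem ketbra_prodVec (x : Fin a → ℂ) (y : Fin b → ℂ) :
    ketbra (prodVec x y) = ketbra x ⊗ₖ ketbra y := by
  ext i j
  simp only [ketbra, prodVec, Matrix.vecMulVec_apply, Matrix.kroneckerMap_apply, Pi.star_apply,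
    star_mul]
  ring

theorem vecF_prodVec {q : ℝ} (hq : 2 ≤ q) (x : Fin a → ℂ) (y : Fin b → ℂ) :
    vecF q (prodVec x y) = 0 := by
  have e : partialTraceB (ketbra (prodVec x y)) = ((ketbra y).trace.re : ℂ) • ketbra x := by
    rw [← trace_eq_ofReal (posSemidef_ketbra y), ketbra_prodVec]
    ext i j
    simp [partialTraceB, Matrix.trace, ← Finset.mul_sum, mul_comm _ (ketbra x i j)]
  rw [vecF, e, homF_smul, homF_ketbra hq, mul_zero]

/-! ### Two-by-two minors -/

/-- The sum of the squared moduli of the `2 × 2` minors of the coefficient matrix. -/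
def minorSq (ψ : Fin a × Fin b → ℂ) : ℝ :=
  ∑ i, ∑ j, ∑ k, ∑ l, Complex.normSq (ψ (i, k) * ψ (j, l) - ψ (i, l) * ψ (j, k))

theorem minorSq_nonneg (ψ : Fin a × Fin b → ℂ) : 0 ≤ minorSq ψ :=
  Finset.sum_nonneg fun _ _ => Finset.sum_nonneg fun _ _ => Finset.sum_nonneg fun _ _ =>
    Finset.sum_nonneg fun _ _ => Complex.normSq_nonneg _

/-- Lagrange's identity for the coefficient matrix: the defect of purity of the reduced state. -/
theorem minorSq_eq (ψ : Fin a × Fin b → ℂ) :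
    (minorSq ψ : ℂ) = 2 * ((partialTraceB (ketbra ψ)).trace ^ 2 -
      (partialTraceB (ketbra ψ) ^ 2).trace) := by
  have h1 : (partialTraceB (ketbra ψ)).trace ^ 2 =
      ∑ i, ∑ j, ∑ k, ∑ l, ψ (i, k) * star (ψ (i, k)) * (ψ (j, l) * star (ψ (j, l))) := by
    simp only [Matrix.trace, Matrix.diag, partialTraceB, ketbra, Matrix.of_apply,
      Matrix.vecMulVec_apply, Pi.star_apply, sq, Finset.sum_mul_sum]
  have h2 : (partialTraceB (ketbra ψ) ^ 2).trace =
      ∑ i, ∑ j, ∑ k, ∑ l, ψ (i, k) * star (ψ (j, k)) * (ψ (j, l) * star (ψ (i, l))) := by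
    simp only [Matrix.trace, Matrix.diag, partialTraceB, ketbra, Matrix.of_apply,
      Matrix.vecMulVec_apply, Pi.star_apply, sq, Matrix.mul_apply, Finset.sum_mul_sum]
  have h1' : (partialTraceB (ketbra ψ)).trace ^ 2 =
      ∑ i, ∑ j, ∑ k, ∑ l, ψ (i, l) * star (ψ (i, l)) * (ψ (j, k) * star (ψ (j, k))) := by
    rw [h1]
    exact Finset.sum_congr rfl fun i _ => Finset.sum_congr rfl fun j _ => Finset.sum_comm
  have h2' : (partialTraceB (ketbra ψ) ^ 2).trace =
      ∑ i, ∑ j, ∑ k, ∑ l, ψ (i, l) * star (ψ (j, l)) * (ψ (j, k) * star (ψ (i, k))) := by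
    rw [h2]
    exact Finset.sum_congr rfl fun i _ => Finset.sum_congr rfl fun j _ => Finset.sum_comm
  have e : ∀ x y : ℂ, 2 * (x - y) = x + x - (y + y) := fun x y => by ring
  rw [e]
  nth_rewrite 1 [h1]
  rw [h1']
  nth_rewrite 1 [h2]
  rw [h2']
  simp only [minorSq, Complex.ofReal_sum, ← Finset.sum_add_distrib, ← Finset.sum_sub_distrib]
  refine Finset.sum_congr rfl fun i _ => Finset.sum_congr rfl fun j _ =>
    Finset.sum_congr rfl fun k _ => Finset.sum_congr rfl fun l _ => ?_
  rw [Complex.normSq_eq_conj_mul_self]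
  simp only [map_sub, map_mul, Complex.star_def]
  ring

theorem trace_sq_re_eq_sum {n : Type} [Fintype n] [DecidableEq n] {X : Matrix n n ℂ}
    (hX : X.IsHermitian) : (X ^ 2).trace.re = ∑ i, hX.eigenvalues i ^ 2 := by
  have hX' : IsSelfAdjoint X := hX
  rw [← traceFn_eq_sum hX fun x => x ^ 2, traceFn, cfc_pow_id X 2]

theorem minorSq_le_vecF {q : ℝ} (hq : 2 ≤ q) {ψ : Fin a × Fin b → ℂ} (hψ : IsUnitVec ψ) :
    minorSq ψ ≤ vecF q ψ := by
  have hX := posSemidef_partialTraceB_ketbra ψ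
  have ht : (partialTraceB (ketbra ψ)).trace = 1 := by
    rw [trace_partialTraceB, trace_ketbra, hψ]
  have h := congrArg Complex.re (minorSq_eq ψ)
  have h1 : ∑ i, hX.isHermitian.eigenvalues i = 1 := by
    rw [← trace_re_eq_sum, ht, Complex.one_re]
  rw [ht, Complex.ofReal_re, Complex.mul_re, Complex.sub_re, trace_sq_re_eq_sum hX.isHermitian] at h
  simp only [Complex.re_ofNat, Complex.im_ofNat, zero_mul, sub_zero, one_pow, Complex.one_re] at h
  rw [vecF, homF_of_trace_one hX.isHermitian ht, totalF_eq_traceFn hX.isHermitian ht,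
    traceFn_eq_sum hX.isHermitian, h, ← h1, ← Finset.sum_sub_distrib, Finset.mul_sum]
  exact Finset.sum_le_sum fun i _ => two_mul_le_entFn hq (eigenvalues_mem_Icc hX (by simp [ht]) i)

/-- If the `2 × 2` minors vanish, all columns of the coefficient matrix are proportional to a
nonzero one. -/
theorem exists_eq_prodVec {ψ : Fin a × Fin b → ℂ} (h : minorSq ψ = 0) :
    ∃ x y, ψ = prodVec x y := by
  by_cases h0 : ψ = 0
  · exact ⟨0, 0, by ext; simp [h0, prodVec]⟩
  obtain ⟨⟨i₀, k₀⟩, hne⟩ := Function.ne_iff.1 h0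
  refine ⟨fun i => ψ (i, k₀), fun k => ψ (i₀, k) / ψ (i₀, k₀), ?_⟩
  ext ⟨i, k⟩
  have hn := fun i j k l => Complex.normSq_nonneg (ψ (i, k) * ψ (j, l) - ψ (i, l) * ψ (j, k))
  have h1 := (Finset.sum_eq_zero_iff_of_nonneg fun i _ => Finset.sum_nonneg fun j _ =>
    Finset.sum_nonneg fun k _ => Finset.sum_nonneg fun l _ => hn i j k l).1 h i (Finset.mem_univ _)
  have h2 := (Finset.sum_eq_zero_iff_of_nonneg fun j _ =>
    Finset.sum_nonneg fun k _ => Finset.sum_nonneg fun l _ => hn i j k l).1 h1 i₀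
      (Finset.mem_univ _)
  have h3 := (Finset.sum_eq_zero_iff_of_nonneg fun k _ =>
    Finset.sum_nonneg fun l _ => hn i i₀ k l).1 h2 k (Finset.mem_univ _)
  have h4 := (Finset.sum_eq_zero_iff_of_nonneg fun l _ => hn i i₀ k l).1 h3 k₀ (Finset.mem_univ _)
  have h5 := sub_eq_zero.1 (Complex.normSq_eq_zero.1 h4)
  have hne' : ψ (i₀, k₀) ≠ 0 := hne
  simp only [prodVec]
  field_simp
  exact h5

/-! ### Local measurements and LOCC protocols -/

theorem coeffMat_alice {a' : ℕ} (K : Matrix (Fin a') (Fin a) ℂ) (ψ : Fin a × Fin b → ℂ) :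
    coeffMat ((K ⊗ₖ (1 : Matrix (Fin b) (Fin b) ℂ)) *ᵥ ψ) = K * coeffMat ψ := by
  ext i k
  simp [coeffMat, Matrix.mulVec, dotProduct, Fintype.sum_prod_type, Matrix.mul_apply,
    Matrix.one_apply]

theorem coeffMat_bob {b' : ℕ} (K : Matrix (Fin b') (Fin b) ℂ) (ψ : Fin a × Fin b → ℂ) :
    coeffMat (((1 : Matrix (Fin a) (Fin a) ℂ) ⊗ₖ K) *ᵥ ψ) = coeffMat ψ * Kᵀ := by
  ext i k
  simp [coeffMat, Matrix.mulVec, dotProduct, Fintype.sum_prod_type, Matrix.mul_apply,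
    Matrix.one_apply, mul_comm]

/-- A measurement of Bob splits the reduced state of Alice into a sum. -/
theorem sum_vecF_bob_le {q : ℝ} (hq : 2 ≤ q) {n : ℕ} (dim : Fin n → ℕ)
    (K : ∀ i, Matrix (Fin (dim i)) (Fin b) ℂ) (hK : ∑ i, (K i)ᴴ * K i = 1)
    (ψ : Fin a × Fin b → ℂ) :
    ∑ i, vecF q (((1 : Matrix (Fin a) (Fin a) ℂ) ⊗ₖ K i) *ᵥ ψ) ≤ vecF q ψ := by
  simp only [vecF, partialTraceB_ketbra, coeffMat_bob]
  refine (sum_homF_le hq _ fun i => Matrix.posSemidef_self_mul_conjTranspose _).trans_eq ?_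
  congr 1
  have hK' : ∑ i, (K i)ᵀ * ((K i)ᵀ)ᴴ = 1 := by
    have := congrArg Matrix.transpose hK
    rw [Matrix.transpose_sum, Matrix.transpose_one] at this
    rw [← this]
    refine Finset.sum_congr rfl fun i _ => ?_
    rw [Matrix.transpose_mul]
    rfl
  calc ∑ i, coeffMat ψ * (K i)ᵀ * (coeffMat ψ * (K i)ᵀ)ᴴ
      = coeffMat ψ * (∑ i, (K i)ᵀ * ((K i)ᵀ)ᴴ) * (coeffMat ψ)ᴴ := by
        simp only [Matrix.mul_sum, Matrix.sum_mul, Matrix.conjTranspose_mul, Matrix.mul_assoc]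
    _ = _ := by rw [hK', Matrix.mul_one]

/-- A measurement of Alice splits the reduced state of Bob into a sum, and both reduced states give
the same value of `homF`. -/
theorem sum_vecF_alice_le {q : ℝ} (hq : 2 ≤ q) {n : ℕ} (dim : Fin n → ℕ)
    (K : ∀ i, Matrix (Fin (dim i)) (Fin a) ℂ) (hK : ∑ i, (K i)ᴴ * K i = 1)
    (ψ : Fin a × Fin b → ℂ) :
    ∑ i, vecF q ((K i ⊗ₖ (1 : Matrix (Fin b) (Fin b) ℂ)) *ᵥ ψ) ≤ vecF q ψ := by
  simp only [vecF, partialTraceB_ketbra, coeffMat_alice, homF_mul_conjTranspose_comm hq]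
  refine (sum_homF_le hq _ fun i => Matrix.posSemidef_conjTranspose_mul_self _).trans_eq ?_
  congr 1
  calc ∑ i, (K i * coeffMat ψ)ᴴ * (K i * coeffMat ψ)
      = (coeffMat ψ)ᴴ * (∑ i, (K i)ᴴ * K i) * coeffMat ψ := by
        simp only [Matrix.mul_sum, Matrix.sum_mul, Matrix.conjTranspose_mul, Matrix.mul_assoc]
    _ = _ := by rw [hK, Matrix.mul_one]

/-- `IsLOCCKraus` carries no finiteness of the outcome types; for the later stages of a protocol
it is inherited from the type of all records. -/
theorem finite_fiber {n : ℕ} {κ : Fin n → Type} [Fintype (Σ i, κ i)] (i : Fin n) : Finite (κ i) :=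
  Finite.of_injective (Sigma.mk i) sigma_mk_injective

theorem IsLOCCKraus.sum_vecF_le {q : ℝ} (hq : 2 ≤ q) {a' b' : ℕ} {ι : Type}
    {A : ι → Matrix (Fin a' × Fin b') (Fin a × Fin b) ℂ} (hA : IsLOCCKraus A) :
    ∀ [Fintype ι] (ψ : Fin a × Fin b → ℂ), ∑ i, vecF q (A i *ᵥ ψ) ≤ vecF q ψ := by
  induction hA with
  | done =>
    intro hι ψ
    rw [Fintype.sum_unique]
    simp
  | @alice a b n dim K hK κ L hL ih =>
    intro hι ψ
    have := fun i => @Fintype.ofFinite _ (finite_fiber (κ := κ) i)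
    rw [Subsingleton.elim hι Sigma.instFintype, Fintype.sum_sigma]
    refine le_trans (Finset.sum_le_sum fun i _ => ?_) (sum_vecF_alice_le hq dim K hK ψ)
    simp only [← Matrix.mulVec_mulVec]
    exact ih i _
  | @bob a b n dim K hK κ L hL ih =>
    intro hι ψ
    have := fun i => @Fintype.ofFinite _ (finite_fiber (κ := κ) i)
    rw [Subsingleton.elim hι Sigma.instFintype, Fintype.sum_sigma]
    refine le_trans (Finset.sum_le_sum fun i _ => ?_) (sum_vecF_bob_le hq dim K hK ψ)
    simp only [← Matrix.mulVec_mulVec]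
    exact ih i _

theorem IsLOCCKraus.sum_conjTranspose_mul {a' b' : ℕ} {ι : Type}
    {A : ι → Matrix (Fin a' × Fin b') (Fin a × Fin b) ℂ} (hA : IsLOCCKraus A) :
    ∀ [Fintype ι],
    ∑ i, (A i)ᴴ * A i = 1 := by
  induction hA with
  | done =>
    intro hι
    rw [Fintype.sum_unique]
    simp
  | @alice a b n dim K hK κ L hL ih =>
    intro hι
    have := fun i => @Fintype.ofFinite _ (finite_fiber (κ := κ) i)
    rw [Subsingleton.elim hι Sigma.instFintype, Fintype.sum_sigma]
    have h : ∀ i, ∑ x, (L i x * (K i ⊗ₖ (1 : Matrix (Fin b) (Fin b) ℂ)))ᴴ *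
        (L i x * (K i ⊗ₖ (1 : Matrix (Fin b) (Fin b) ℂ))) =
        ((K i)ᴴ * K i) ⊗ₖ (1 : Matrix (Fin b) (Fin b) ℂ) := fun i => by
      calc _ = (K i ⊗ₖ (1 : Matrix (Fin b) (Fin b) ℂ))ᴴ * (∑ x, (L i x)ᴴ * L i x) *
              (K i ⊗ₖ (1 : Matrix (Fin b) (Fin b) ℂ)) := by
            simp only [Matrix.mul_sum, Matrix.sum_mul, Matrix.conjTranspose_mul, Matrix.mul_assoc]
        _ = _ := by
          rw [ih i, Matrix.mul_one, Matrix.conjTranspose_kronecker, ← Matrix.mul_kronecker_mul]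
          simp
    simp only [h]
    rw [← Matrix.one_kronecker_one, ← hK]
    ext x y
    simp [Matrix.sum_apply, Finset.sum_mul]
  | @bob a b n dim K hK κ L hL ih =>
    intro hι
    have := fun i => @Fintype.ofFinite _ (finite_fiber (κ := κ) i)
    rw [Subsingleton.elim hι Sigma.instFintype, Fintype.sum_sigma]
    have h : ∀ i, ∑ x, (L i x * ((1 : Matrix (Fin a) (Fin a) ℂ) ⊗ₖ K i))ᴴ *
        (L i x * ((1 : Matrix (Fin a) (Fin a) ℂ) ⊗ₖ K i)) =
        (1 : Matrix (Fin a) (Fin a) ℂ) ⊗ₖ ((K i)ᴴ * K i) := fun i => by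
      calc _ = ((1 : Matrix (Fin a) (Fin a) ℂ) ⊗ₖ K i)ᴴ * (∑ x, (L i x)ᴴ * L i x) *
              ((1 : Matrix (Fin a) (Fin a) ℂ) ⊗ₖ K i) := by
            simp only [Matrix.mul_sum, Matrix.sum_mul, Matrix.conjTranspose_mul, Matrix.mul_assoc]
        _ = _ := by
          rw [ih i, Matrix.mul_one, Matrix.conjTranspose_kronecker, ← Matrix.mul_kronecker_mul]
          simp
    simp only [h]
    rw [← Matrix.one_kronecker_one, ← hK]
    ext x y
    simp [Matrix.sum_apply, Finset.mul_sum]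

/-- Local unitaries form an LOCC protocol with a single outcome record. -/
theorem isLOCCMap_unitary {U : Matrix (Fin a) (Fin a) ℂ} {V : Matrix (Fin b) (Fin b) ℂ}
    (hU : U ∈ Matrix.unitaryGroup (Fin a) ℂ) (hV : V ∈ Matrix.unitaryGroup (Fin b) ℂ) :
    IsLOCCMap fun X => (U ⊗ₖ V) * X * (U ⊗ₖ V)ᴴ := by
  have h1 := IsLOCCKraus.bob (a := a) (n := 1) (fun _ => b) (fun _ => V)
    (by simpa using! Matrix.mem_unitaryGroup_iff'.1 hV) (fun _ _ => 1)
    fun _ => IsLOCCKraus.done (a' := a) (b' := b)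
  have h2 := IsLOCCKraus.alice (b := b) (n := 1) (fun _ => a) (fun _ => U)
    (by simpa using! Matrix.mem_unitaryGroup_iff'.1 hU) (fun _ => _) fun _ => h1
  refine ⟨_, inferInstance, _, h2, fun X => ?_⟩
  have e : ((1 : Matrix (Fin a) (Fin a) ℂ) ⊗ₖ V) * (U ⊗ₖ (1 : Matrix (Fin b) (Fin b) ℂ)) =
      U ⊗ₖ V := by
    rw [← Matrix.mul_kronecker_mul, Matrix.one_mul, Matrix.mul_one]
  simp [e]

end Vectors

/-! ### Pure-state ensembles as families of unnormalized vectors -/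

section Ensembles

variable {d : ℕ} {q : ℝ}

theorem exists_isUnitVec (hd : 2 ≤ d) :
    ∃ ψ : Fin d × Fin d → ℂ, IsUnitVec ψ :=
  ⟨Pi.single (⟨0, by omega⟩, ⟨0, by omega⟩) 1, by simp [IsUnitVec]⟩

theorem isUnitVec_normalized {ι : Type} [Fintype ι] {φ : ι → ℂ}
    (h : (ketbra φ).trace.re ≠ 0) :
    IsUnitVec (((√(ketbra φ).trace.re⁻¹ : ℝ) : ℂ) • φ) := by
  have h0 := trace_re_nonneg (posSemidef_ketbra φ)
  rw [IsUnitVec, ← trace_ketbra, ketbra_sqrt_smul (inv_nonneg.2 h0), Matrix.trace_smul,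
    trace_eq_ofReal (posSemidef_ketbra φ), smul_eq_mul, ← Complex.ofReal_mul, Complex.ofReal_re,
    inv_mul_cancel₀ h, Complex.ofReal_one]

/-- A vector is a scalar multiple of a unit vector. The weight is `0` for the zero vector, where the
unit vector is arbitrary. -/
theorem exists_isUnitVec_ketbra_eq (hd : 2 ≤ d) (φ : Fin d × Fin d → ℂ) :
    ∃ ψ : Fin d × Fin d → ℂ, IsUnitVec ψ ∧
      ketbra φ = ((ketbra φ).trace.re : ℂ) • ketbra ψ ∧
      vecF q φ = (ketbra φ).trace.re * vecF q ψ := by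
  have hpos := trace_re_nonneg (posSemidef_ketbra φ)
  rcases eq_or_ne (ketbra φ).trace.re 0 with h | h
  · obtain ⟨ψ, hψ⟩ := exists_isUnitVec hd
    have hz := eq_zero_of_trace_re (posSemidef_ketbra φ) h
    refine ⟨ψ, hψ, by rw [h, hz]; simp, ?_⟩
    rw [h, zero_mul, vecF, homF, trace_partialTraceB, h, zero_mul]
  · refine ⟨_, isUnitVec_normalized h, ?_, ?_⟩
    · rw [ketbra_sqrt_smul (inv_nonneg.2 hpos), smul_smul, ← Complex.ofReal_mul,
        mul_inv_cancel₀ h, Complex.ofReal_one, one_smul]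
    · rw [vecF_sqrt_smul q (inv_nonneg.2 hpos), mul_inv_cancel_left₀ h]

theorem pureConcurrence_nonneg (hd : 2 ≤ d) (hq : 2 ≤ q) {ψ : Fin d × Fin d → ℂ}
    (hψ : IsUnitVec ψ) : 0 ≤ pureConcurrence q ψ := by
  rw [pureConcurrence_eq q hψ]
  exact div_nonneg (vecF_nonneg hq ψ) (normFactor_pos hd hq).le

theorem nonneg_of_mem_ensembleAverages (hd : 2 ≤ d) (hq : 2 ≤ q)
    {ρ : Matrix (Fin d × Fin d) (Fin d × Fin d) ℂ} {x : ℝ} (hx : x ∈ ensembleAverages q ρ) :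
    0 ≤ x := by
  obtain ⟨n, p, ψ, hp, -, hψ, -, rfl⟩ := hx
  exact Finset.sum_nonneg fun i _ => mul_nonneg (hp i) (pureConcurrence_nonneg hd hq (hψ i))

theorem bddBelow_ensembleAverages (hd : 2 ≤ d) (hq : 2 ≤ q)
    (ρ : Matrix (Fin d × Fin d) (Fin d × Fin d) ℂ) : BddBelow (ensembleAverages q ρ) :=
  ⟨0, fun _ hx => nonneg_of_mem_ensembleAverages hd hq hx⟩

theorem concurrence_nonneg (hd : 2 ≤ d) (hq : 2 ≤ q)
    (ρ : Matrix (Fin d × Fin d) (Fin d × Fin d) ℂ) : 0 ≤ concurrence q ρ :=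
  Real.sInf_nonneg fun _ hx => nonneg_of_mem_ensembleAverages hd hq hx

/-- A decomposition into unnormalized vectors gives a pure-state ensemble. -/
theorem sum_vecF_mem_ensembleAverages (hd : 2 ≤ d) {κ : Type} (s : Finset κ)
    (φ : κ → Fin d × Fin d → ℂ) (ht : (∑ x ∈ s, ketbra (φ x)).trace = 1) :
    (∑ x ∈ s, vecF q (φ x)) / normFactor d q ∈ ensembleAverages q (∑ x ∈ s, ketbra (φ x)) := by
  choose ψ hψ hk hv using fun x => exists_isUnitVec_ketbra_eq (q := q) hd (φ x)
  have hre : ∀ g : κ → ℝ, ∑ i : Fin s.card, g (s.equivFin.symm i) = ∑ x ∈ s, g x := fun g => by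
    rw [← Finset.sum_coe_sort s]
    exact Equiv.sum_comp s.equivFin.symm fun x : s => g x
  refine ⟨s.card, fun i => (ketbra (φ (s.equivFin.symm i))).trace.re,
    fun i => ψ (s.equivFin.symm i), fun i => trace_re_nonneg (posSemidef_ketbra _), ?_,
    fun i => hψ _, ?_, ?_⟩
  · rw [hre fun x => (ketbra (φ x)).trace.re, ← Complex.re_sum, ← Matrix.trace_sum, ht,
      Complex.one_re]
  · simp only [← hk]
    rw [← Finset.sum_coe_sort s]
    exact (Equiv.sum_comp s.equivFin.symm fun x : s => ketbra (φ x)).symm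
  · rw [hre fun x => (ketbra (φ x)).trace.re * pureConcurrence q (ψ x), Finset.sum_div]
    refine Finset.sum_congr rfl fun x _ => ?_
    rw [pureConcurrence_eq q (hψ x), hv x, mul_div_assoc]

theorem concurrence_sum_ketbra_le (hd : 2 ≤ d) (hq : 2 ≤ q) {κ : Type} (s : Finset κ)
    (φ : κ → Fin d × Fin d → ℂ) (ht : (∑ x ∈ s, ketbra (φ x)).trace = 1) :
    concurrence q (∑ x ∈ s, ketbra (φ x)) ≤ (∑ x ∈ s, vecF q (φ x)) / normFactor d q :=
  csInf_le (bddBelow_ensembleAverages hd hq _) (sum_vecF_mem_ensembleAverages hd s φ ht)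

/-- The same bound for an unnormalized state; where `tr X = 0` the left-hand side is `0`. -/
theorem trace_mul_concurrence_le (hd : 2 ≤ d) (hq : 2 ≤ q) {κ : Type} (s : Finset κ)
    (φ : κ → Fin d × Fin d → ℂ) {X : Matrix (Fin d × Fin d) (Fin d × Fin d) ℂ}
    (hX : X = ∑ x ∈ s, ketbra (φ x)) :
    X.trace.re * concurrence q (((X.trace.re⁻¹ : ℝ) : ℂ) • X) ≤
      (∑ x ∈ s, vecF q (φ x)) / normFactor d q := by
  have hpsd : X.PosSemidef := hX ▸ Matrix.posSemidef_sum _ fun x _ => posSemidef_ketbra _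
  have hμ := normFactor_pos hd hq
  rcases eq_or_ne X.trace.re 0 with h0 | h0
  · rw [h0, zero_mul]
    exact div_nonneg (Finset.sum_nonneg fun x _ => vecF_nonneg hq _) hμ.le
  have hc := inv_nonneg.2 (trace_re_nonneg hpsd)
  have e : ((X.trace.re⁻¹ : ℝ) : ℂ) • X =
      ∑ x ∈ s, ketbra (((√X.trace.re⁻¹ : ℝ) : ℂ) • φ x) := by
    simp only [ketbra_sqrt_smul hc, ← Finset.smul_sum, ← hX]
  have h1 : (((X.trace.re⁻¹ : ℝ) : ℂ) • X).trace = 1 := by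
    rw [Matrix.trace_smul, trace_eq_ofReal hpsd, smul_eq_mul, ← Complex.ofReal_mul,
      Complex.ofReal_re, inv_mul_cancel₀ h0, Complex.ofReal_one]
  have h2 := concurrence_sum_ketbra_le hd hq s (fun x => ((√X.trace.re⁻¹ : ℝ) : ℂ) • φ x)
    (e ▸ h1)
  rw [← e] at h2
  simp only [vecF_sqrt_smul q hc, ← Finset.mul_sum] at h2
  calc _ ≤ X.trace.re * (X.trace.re⁻¹ * ∑ x ∈ s, vecF q (φ x) / normFactor d q) := by
        rw [← Finset.sum_div, ← mul_div_assoc]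
        exact mul_le_mul_of_nonneg_left h2 (trace_re_nonneg hpsd)
    _ = _ := by rw [mul_inv_cancel_left₀ h0, Finset.sum_div]

open scoped MatrixOrder in
theorem exists_eq_sum_ketbra {ι : Type} [Fintype ι] [DecidableEq ι] {X : Matrix ι ι ℂ}
    (hX : X.PosSemidef) : ∃ φ : ι → ι → ℂ, X = ∑ k, ketbra (φ k) := by
  obtain ⟨B, rfl⟩ := CStarAlgebra.nonneg_iff_eq_star_mul_self.1
    (Matrix.nonneg_iff_posSemidef.2 hX)
  refine ⟨fun k => star (B k), ?_⟩
  ext i j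
  simp [Matrix.mul_apply, Matrix.sum_apply, ketbra, Matrix.vecMulVec_apply]

theorem ensembleAverages_nonempty (hd : 2 ≤ d)
    {ρ : Matrix (Fin d × Fin d) (Fin d × Fin d) ℂ} (hρ : IsDensity ρ) :
    (ensembleAverages q ρ).Nonempty := by
  obtain ⟨φ, rfl⟩ := exists_eq_sum_ketbra hρ.1
  exact ⟨_, sum_vecF_mem_ensembleAverages hd Finset.univ φ hρ.2⟩

/-- Nearly optimal decompositions, with unnormalized vectors. -/
theorem exists_sum_vecF_lt (hd : 2 ≤ d)
    {ρ : Matrix (Fin d × Fin d) (Fin d × Fin d) ℂ} (hρ : IsDensity ρ) {ε : ℝ} (hε : 0 < ε) :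
    ∃ (n : ℕ) (φ : Fin n → Fin d × Fin d → ℂ), ρ = ∑ j, ketbra (φ j) ∧
      (∑ j, vecF q (φ j)) / normFactor d q < concurrence q ρ + ε := by
  obtain ⟨x, ⟨n, p, ψ, hp, -, hψ, hρ', rfl⟩, hx⟩ := exists_lt_of_csInf_lt
    (ensembleAverages_nonempty (q := q) hd hρ) (lt_add_of_pos_right (concurrence q ρ) hε)
  refine ⟨n, fun j => ((√(p j) : ℝ) : ℂ) • ψ j, ?_, lt_of_eq_of_lt ?_ hx⟩
  · simp only [ketbra_sqrt_smul (hp _), hρ']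
  · rw [Finset.sum_div]
    refine Finset.sum_congr rfl fun j _ => ?_
    rw [vecF_sqrt_smul q (hp j), pureConcurrence_eq q (hψ j), mul_div_assoc]

/-! ### Convexity and monotonicity -/

theorem concurrence_convex (hd : 2 ≤ d) (hq : 2 ≤ q) {n : ℕ} (p : Fin n → ℝ)
    (ρ : Fin n → Matrix (Fin d × Fin d) (Fin d × Fin d) ℂ) (hp : ∀ i, 0 ≤ p i)
    (hp1 : ∑ i, p i = 1) (hρ : ∀ i, IsDensity (ρ i)) :
    concurrence q (∑ i, (p i : ℂ) • ρ i) ≤ ∑ i, p i * concurrence q (ρ i) := by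
  refine le_of_forall_pos_le_add fun ε hε => ?_
  choose m φ hφ hv using fun i => exists_sum_vecF_lt (q := q) hd (hρ i) hε
  have e : ∑ i, (p i : ℂ) • ρ i =
      ∑ x : Σ i, Fin (m i), ketbra (((√(p x.1) : ℝ) : ℂ) • φ x.1 x.2) := by
    rw [Fintype.sum_sigma]
    refine Finset.sum_congr rfl fun i _ => ?_
    simp only [ketbra_sqrt_smul (hp i), ← Finset.smul_sum, ← hφ i]
  have ht : (∑ i, (p i : ℂ) • ρ i).trace = 1 := by
    simp only [Matrix.trace_sum, Matrix.trace_smul, (hρ _).2, smul_eq_mul, mul_one]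
    rw [← Complex.ofReal_sum, hp1, Complex.ofReal_one]
  have h := concurrence_sum_ketbra_le hd hq Finset.univ
    (fun x : Σ i, Fin (m i) => ((√(p x.1) : ℝ) : ℂ) • φ x.1 x.2) (e ▸ ht)
  rw [← e, Fintype.sum_sigma, Finset.sum_div] at h
  refine h.trans ?_
  calc _ ≤ ∑ i, p i * (concurrence q (ρ i) + ε) := by
        refine Finset.sum_le_sum fun i _ => ?_
        simp only [vecF_sqrt_smul q (hp i), ← Finset.mul_sum]
        rw [mul_div_assoc]
        exact mul_le_mul_of_nonneg_left (hv i).le (hp i)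
    _ = _ := by simp only [mul_add, Finset.sum_add_distrib, ← Finset.sum_mul, hp1, one_mul]

open Classical in
/-- Monotonicity under LOCC instruments. The vectors `A i φ j` of a nearly optimal decomposition
decompose all the unnormalized outcome states at once. -/
theorem sum_trace_mul_concurrence_le (hd : 2 ≤ d) (hq : 2 ≤ q)
    {ρ : Matrix (Fin d × Fin d) (Fin d × Fin d) ℂ} (hρ : IsDensity ρ) {ι κ : Type} [Fintype ι]
    [Fintype κ] {A : ι → Matrix (Fin d × Fin d) (Fin d × Fin d) ℂ} (hA : IsLOCCKraus A)
    (f : ι → κ) {M : κ → Matrix (Fin d × Fin d) (Fin d × Fin d) ℂ}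
    (hM : ∀ k, M k = ∑ i with f i = k, A i * ρ * (A i)ᴴ) :
    ∑ k, (M k).trace.re * concurrence q ((((M k).trace.re⁻¹ : ℝ) : ℂ) • M k) ≤
      concurrence q ρ := by
  refine le_of_forall_pos_le_add fun ε hε => ?_
  obtain ⟨n, φ, hφ, hv⟩ := exists_sum_vecF_lt (q := q) hd hρ hε
  refine le_trans ?_ hv.le
  have h1 : ∀ k, (M k).trace.re * concurrence q ((((M k).trace.re⁻¹ : ℝ) : ℂ) • M k) ≤
      (∑ i with f i = k, ∑ j, vecF q (A i *ᵥ φ j)) / normFactor d q := fun k => by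
    have h := trace_mul_concurrence_le hd hq
      ((Finset.univ.filter fun i => f i = k) ×ˢ (Finset.univ : Finset (Fin n)))
      (fun x => A x.1 *ᵥ φ x.2) (X := M k) (by
        rw [hM, Finset.sum_product]
        refine Finset.sum_congr rfl fun i _ => ?_
        conv_lhs => rw [hφ]
        simp only [Matrix.mul_sum, Matrix.sum_mul, mul_ketbra_mul])
    rwa [Finset.sum_product] at h
  refine (Finset.sum_le_sum fun k _ => h1 k).trans ?_
  have h2 : ∑ k, ∑ i with f i = k, ∑ j, vecF q (A i *ᵥ φ j) = ∑ i, ∑ j, vecF q (A i *ᵥ φ j) := by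
    convert Finset.sum_fiberwise Finset.univ f fun i => ∑ j, vecF q (A i *ᵥ φ j)
  rw [← Finset.sum_div, h2, Finset.sum_comm]
  exact div_le_div_of_nonneg_right (Finset.sum_le_sum fun j _ => hA.sum_vecF_le hq (φ j))
    (normFactor_pos hd hq).le

theorem IsLOCCMap.isDensity {Λ : Matrix (Fin d × Fin d) (Fin d × Fin d) ℂ →
    Matrix (Fin d × Fin d) (Fin d × Fin d) ℂ} (hΛ : IsLOCCMap Λ)
    {ρ : Matrix (Fin d × Fin d) (Fin d × Fin d) ℂ} (hρ : IsDensity ρ) : IsDensity (Λ ρ) := by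
  obtain ⟨ι, _, A, hA, h⟩ := hΛ
  refine ⟨h ρ ▸ Matrix.posSemidef_sum _ fun i _ => hρ.1.mul_mul_conjTranspose_same _, ?_⟩
  calc (Λ ρ).trace = ((∑ i, (A i)ᴴ * A i) * ρ).trace := by
        rw [h, Matrix.sum_mul, Matrix.trace_sum, Matrix.trace_sum]
        refine Finset.sum_congr rfl fun i _ => ?_
        rw [Matrix.trace_mul_comm, Matrix.mul_assoc]
    _ = 1 := by rw [hA.sum_conjTranspose_mul, Matrix.one_mul, hρ.2]

theorem concurrence_locc_le (hd : 2 ≤ d) (hq : 2 ≤ q)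
    {Λ : Matrix (Fin d × Fin d) (Fin d × Fin d) ℂ →
      Matrix (Fin d × Fin d) (Fin d × Fin d) ℂ} (hΛ : IsLOCCMap Λ)
    {ρ : Matrix (Fin d × Fin d) (Fin d × Fin d) ℂ} (hρ : IsDensity ρ) :
    concurrence q (Λ ρ) ≤ concurrence q ρ := by
  have ht := (hΛ.isDensity hρ).2
  obtain ⟨ι, _, A, hA, h⟩ := hΛ
  have := sum_trace_mul_concurrence_le hd hq hρ hA (fun _ => ()) (M := fun _ => Λ ρ)
    fun k => by simp [h]
  simpa [ht] using this

theorem concurrence_local_unitary (hd : 2 ≤ d) (hq : 2 ≤ q)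
    {ρ : Matrix (Fin d × Fin d) (Fin d × Fin d) ℂ} (hρ : IsDensity ρ)
    {U V : Matrix (Fin d) (Fin d) ℂ} (hU : U ∈ Matrix.unitaryGroup (Fin d) ℂ)
    (hV : V ∈ Matrix.unitaryGroup (Fin d) ℂ) :
    concurrence q ((U ⊗ₖ V) * ρ * (U ⊗ₖ V)ᴴ) = concurrence q ρ := by
  have hΛ := isLOCCMap_unitary hU hV
  refine le_antisymm (concurrence_locc_le hd hq hΛ hρ) ?_
  have h := concurrence_locc_le hd hq (isLOCCMap_unitary (Unitary.star_mem hU)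
    (Unitary.star_mem hV)) (hΛ.isDensity hρ)
  have e : (star U ⊗ₖ star V) * (U ⊗ₖ V) = 1 := by
    rw [← Matrix.mul_kronecker_mul, Matrix.mem_unitaryGroup_iff'.1 hU,
      Matrix.mem_unitaryGroup_iff'.1 hV, Matrix.one_kronecker_one]
  have e2 : (star U ⊗ₖ star V) * ((U ⊗ₖ V) * ρ * (U ⊗ₖ V)ᴴ) * (star U ⊗ₖ star V)ᴴ = ρ := by
    calc _ = ((star U ⊗ₖ star V) * (U ⊗ₖ V)) * ρ * ((star U ⊗ₖ star V) * (U ⊗ₖ V))ᴴ := by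
          simp only [Matrix.conjTranspose_mul, Matrix.mul_assoc]
      _ = ρ := by rw [e]; simp
  rwa [e2] at h

/-! ### Pure states -/

/-- A pure state has no pure-state decompositions but the trivial one. -/
theorem ketbra_eq_of_mixture {ι : Type} [Fintype ι] [DecidableEq ι] {ψ : ι → ℂ}
    (hψ : IsUnitVec ψ) {n : ℕ} {p : Fin n → ℝ} (hp : ∀ i, 0 ≤ p i) {φ : Fin n → ι → ℂ}
    (hφ : ∀ i, IsUnitVec (φ i)) (h : ketbra ψ = ∑ i, (p i : ℂ) • ketbra (φ i)) {i : Fin n}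
    (hi : p i ≠ 0) : ketbra (φ i) = ketbra ψ := by
  -- `Q` is the projection onto the orthogonal complement of `ψ`
  set Q := 1 - ketbra ψ with hQ
  have hQψ : Q *ᵥ ψ = 0 := by
    rw [hQ, Matrix.sub_mulVec, Matrix.one_mulVec, ketbra, Matrix.vecMulVec_mulVec, hψ]
    simp
  have h1 : ∑ i, (p i : ℂ) • ketbra (Q *ᵥ φ i) = 0 := by
    have h2 := congrArg (fun X => Q * X * Qᴴ) h
    simp only [Matrix.mul_sum, Matrix.sum_mul, Matrix.mul_smul, Matrix.smul_mul, mul_ketbra_mul,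
      hQψ] at h2
    rw [← h2]
    ext
    simp [ketbra, Matrix.vecMulVec_apply]
  have h2 : ∑ i, p i * (ketbra (Q *ᵥ φ i)).trace.re = 0 := by
    have := congrArg (fun X => X.trace.re) h1
    simpa [Matrix.trace_sum, Complex.re_sum] using this
  have h3 := (Finset.sum_eq_zero_iff_of_nonneg fun i _ => mul_nonneg (hp i)
    (trace_re_nonneg (posSemidef_ketbra _))).1 h2 i (Finset.mem_univ i)
  have h4 := eq_zero_of_trace_re (posSemidef_ketbra _) ((mul_eq_zero.1 h3).resolve_left hi)
  have h5 : Q *ᵥ φ i = 0 := by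
    rw [← dotProduct_star_self_eq_zero, ← trace_ketbra, h4, Matrix.trace_zero]
  have h6 : φ i = (star ψ ⬝ᵥ φ i) • ψ := by
    rw [hQ, Matrix.sub_mulVec, Matrix.one_mulVec, ketbra, Matrix.vecMulVec_mulVec, sub_eq_zero]
      at h5
    simpa using h5
  have h7 := congrArg ketbra h6
  rw [ketbra_smul] at h7
  have h8 := congrArg Matrix.trace h7
  rw [Matrix.trace_smul, trace_ketbra, trace_ketbra, hψ, hφ i, smul_eq_mul, mul_one] at h8
  rw [h7, ← h8, one_smul]

theorem concurrence_ketbra (hd : 2 ≤ d) {ψ : Fin d × Fin d → ℂ} (hψ : IsUnitVec ψ) :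
    concurrence q (ketbra ψ) = pureConcurrence q ψ := by
  have hρ : IsDensity (ketbra ψ) := ⟨posSemidef_ketbra ψ, by rw [trace_ketbra, hψ]⟩
  have : ensembleAverages q (ketbra ψ) = {pureConcurrence q ψ} := by
    refine (ensembleAverages_nonempty hd hρ).subset_singleton_iff.1 ?_
    rintro x ⟨n, p, φ, hp, hp1, hφ, h, rfl⟩
    rw [Set.mem_singleton_iff, ← one_mul (pureConcurrence q ψ), ← hp1, Finset.sum_mul]
    refine Finset.sum_congr rfl fun i _ => ?_
    rcases eq_or_ne (p i) 0 with hi | hi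
    · rw [hi, zero_mul, zero_mul]
    · rw [pureConcurrence, ketbra_eq_of_mixture hψ hp hφ h hi, pureConcurrence]
  rw [concurrence, this, csInf_singleton]

/-! ### Separable states -/

theorem concurrence_eq_zero_of_isSeparable (hd : 2 ≤ d) (hq : 2 ≤ q)
    {ρ : Matrix (Fin d × Fin d) (Fin d × Fin d) ℂ} (hρ : IsDensity ρ) (hs : IsSeparable ρ) :
    concurrence q ρ = 0 := by
  obtain ⟨n, p, σ, τ, hp, -, hσ, hτ, rfl⟩ := hs
  choose x hx using fun i => exists_eq_sum_ketbra (hσ i).1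
  choose y hy using fun i => exists_eq_sum_ketbra (hτ i).1
  have e : ∑ i, (p i : ℂ) • (σ i ⊗ₖ τ i) = ∑ z : Fin n × Fin d × Fin d,
      ketbra (((√(p z.1) : ℝ) : ℂ) • prodVec (x z.1 z.2.1) (y z.1 z.2.2)) := by
    simp only [Fintype.sum_prod_type, ketbra_sqrt_smul (hp _), ketbra_prodVec]
    refine Finset.sum_congr rfl fun i _ => ?_
    conv_lhs => rw [hx i, hy i]
    simp only [← Finset.smul_sum]
    congr 1
    ext u v
    simp [Matrix.sum_apply, Finset.sum_mul_sum]
  refine le_antisymm ?_ (concurrence_nonneg hd hq _)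
  have h := concurrence_sum_ketbra_le hd hq Finset.univ
    (fun z : Fin n × Fin d × Fin d =>
      ((√(p z.1) : ℝ) : ℂ) • prodVec (x z.1 z.2.1) (y z.1 z.2.2)) (e ▸ hρ.2)
  rw [← e] at h
  simpa only [vecF_sqrt_smul q (hp _), vecF_prodVec hq, mul_zero, Finset.sum_const_zero,
    zero_div] using h

theorem exists_density_kronecker {a b : ℕ} {x : Fin a → ℂ} {y : Fin b → ℂ}
    (h : IsUnitVec (prodVec x y)) :
    ∃ σ τ, IsDensity σ ∧ IsDensity τ ∧ ketbra (prodVec x y) = σ ⊗ₖ τ := by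
  have hx := posSemidef_ketbra x
  have hy := posSemidef_ketbra y
  have ht : (ketbra x).trace.re * (ketbra y).trace.re = 1 := by
    rw [IsUnitVec, ← trace_ketbra, ketbra_prodVec, Matrix.trace_kronecker, trace_eq_ofReal hx,
      trace_eq_ofReal hy, ← Complex.ofReal_mul] at h
    exact_mod_cast h
  refine ⟨((ketbra y).trace.re : ℂ) • ketbra x, ((ketbra x).trace.re : ℂ) • ketbra y,
    ⟨posSemidef_real_smul hx (trace_re_nonneg hy), ?_⟩,
    ⟨posSemidef_real_smul hy (trace_re_nonneg hx), ?_⟩, ?_⟩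
  · rw [Matrix.trace_smul, trace_eq_ofReal hx, smul_eq_mul, ← Complex.ofReal_mul, mul_comm,
      ht, Complex.ofReal_one]
  · rw [Matrix.trace_smul, trace_eq_ofReal hy, smul_eq_mul, ← Complex.ofReal_mul, ht,
      Complex.ofReal_one]
  · rw [Matrix.smul_kronecker, Matrix.kronecker_smul, smul_smul, ← Complex.ofReal_mul, mul_comm,
      ht, Complex.ofReal_one, one_smul, ketbra_prodVec]

/-- In finite dimension the convex hull of a compact set is compact: by Carathéodory's theorem,
convex combinations of boundedly many points suffice. -/
theorem isCompact_convexHull_of_finiteDimensional {E : Type} [AddCommGroup E] [Module ℝ E]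
    [TopologicalSpace E] [ContinuousAdd E] [ContinuousSMul ℝ E] [FiniteDimensional ℝ E]
    {s : Set E} (hs : IsCompact s) : IsCompact (convexHull ℝ s) := by
  have e : convexHull ℝ s = ⋃ m ∈ Finset.range (Module.finrank ℝ E + 2),
      (fun z : (Fin m → ℝ) × (Fin m → E) => ∑ i, z.1 i • z.2 i) ''
        (stdSimplex ℝ (Fin m) ×ˢ Set.univ.pi fun _ => s) := by
    refine Set.Subset.antisymm (fun x hx => ?_) (Set.iUnion₂_subset fun m _ => ?_)
    · obtain ⟨ι, _, z, w, hz, hind, hw, hw1, rfl⟩ := eq_pos_convex_span_of_mem_convexHull hx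
      have hcard : Fintype.card ι ≤ Module.finrank ℝ E + 1 :=
        hind.card_le_finrank_succ.trans (Nat.succ_le_succ (Submodule.finrank_le _))
      have g := (Fintype.equivFin ι).symm
      refine Set.mem_biUnion (x := Fintype.card ι) (by simp; omega)
        ⟨(w ∘ g, z ∘ g), ⟨⟨fun i => (hw _).le, ?_⟩, fun i _ => hz ⟨_, rfl⟩⟩, ?_⟩
      · exact (Equiv.sum_comp g w).trans hw1
      · exact Equiv.sum_comp g fun i => w i • z i
    · rintro _ ⟨⟨w, z⟩, ⟨hw, hz⟩, rfl⟩
      exact (convex_convexHull ℝ s).sum_mem (fun i _ => hw.1 i) hw.2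
        fun i _ => subset_convexHull ℝ s (hz i trivial)
  rw [e]
  refine Finset.isCompact_biUnion _ fun m _ => ?_
  exact ((isCompact_stdSimplex ℝ (Fin m)).prod (isCompact_univ_pi fun _ => hs)).image
    (by fun_prop)

theorem isCompact_isUnitVec {ι : Type} [Fintype ι] : IsCompact {ψ : ι → ℂ | IsUnitVec ψ} := by
  refine Metric.isCompact_of_isClosed_isBounded ?_ ?_
  · exact isClosed_eq (by simp only [dotProduct]; fun_prop) continuous_const
  · refine (Metric.isBounded_closedBall (x := (0 : ι → ℂ)) (r := 1)).subset fun ψ hψ => ?_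
    rw [mem_closedBall_zero_iff, pi_norm_le_iff_of_nonneg zero_le_one]
    intro i
    have h : ∑ j, ‖ψ j‖ ^ 2 = 1 := by
      have h2 := congrArg Complex.re hψ
      simp only [dotProduct, Pi.star_apply, Complex.star_def, ← Complex.normSq_eq_conj_mul_self,
        Complex.re_sum, Complex.ofReal_re, Complex.one_re] at h2
      simpa [Complex.normSq_eq_norm_sq] using h2
    have h3 : ‖ψ i‖ ^ 2 ≤ 1 :=
      h ▸ Finset.single_le_sum (fun j _ => sq_nonneg ‖ψ j‖) (Finset.mem_univ i)
    nlinarith [norm_nonneg (ψ i)]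

/-- Nearly optimal ensembles have a nearly vanishing average of `minorSq`; a limit of them, which
exists by compactness, consists of product vectors. -/
theorem isSeparable_of_concurrence_eq_zero (hd : 2 ≤ d) (hq : 2 ≤ q)
    {ρ : Matrix (Fin d × Fin d) (Fin d × Fin d) ℂ} (hρ : IsDensity ρ)
    (h : concurrence q ρ = 0) : IsSeparable ρ := by
  have hμ := normFactor_pos hd hq
  set G : (Fin d × Fin d → ℂ) → Matrix (Fin d × Fin d) (Fin d × Fin d) ℂ × ℝ :=
    fun ψ => (ketbra ψ, minorSq ψ) with hG
  set K := G '' {ψ | IsUnitVec ψ} with hK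
  have hGc : Continuous G := by
    refine Continuous.prodMk ?_ ?_
    · unfold ketbra
      fun_prop
    · unfold minorSq
      have := Complex.continuous_normSq
      fun_prop
  have hcl : IsClosed (convexHull ℝ K) :=
    (isCompact_convexHull_of_finiteDimensional (isCompact_isUnitVec.image hGc)).isClosed
  have happ : ∀ ε > 0, ∃ x, 0 ≤ x ∧ x < ε ∧ (ρ, x) ∈ convexHull ℝ K := by
    intro ε hε
    obtain ⟨y, ⟨n, p, ψ, hp, hp1, hψ, hρ', rfl⟩, hy⟩ := exists_lt_of_csInf_lt
      (ensembleAverages_nonempty (q := q) hd hρ)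
      (show concurrence q ρ < ε / normFactor d q by rw [h]; exact div_pos hε hμ)
    refine ⟨∑ i, p i * minorSq (ψ i),
      Finset.sum_nonneg fun i _ => mul_nonneg (hp i) (minorSq_nonneg _), ?_, ?_⟩
    · rw [lt_div_iff₀ hμ, Finset.sum_mul] at hy
      refine lt_of_le_of_lt (Finset.sum_le_sum fun i _ => ?_) hy
      rw [pureConcurrence_eq q (hψ i), mul_assoc, div_mul_cancel₀ _ hμ.ne']
      exact mul_le_mul_of_nonneg_left (minorSq_le_vecF hq (hψ i)) (hp i)
    · have := (convex_convexHull ℝ K).sum_mem (t := Finset.univ) (fun i _ => hp i) hp1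
        fun i _ => subset_convexHull ℝ K ⟨ψ i, hψ i, rfl⟩
      convert this using 1
      rw [Prod.ext_iff]
      constructor
      · rw [hρ', Prod.fst_sum]
        rfl
      · rw [Prod.snd_sum]
        rfl
  have hmem : (ρ, (0 : ℝ)) ∈ convexHull ℝ K := by
    choose x hx0 hx1 hx using fun n : ℕ => happ (1 / (n + 1)) Nat.one_div_pos_of_nat
    refine hcl.mem_of_tendsto (f := fun n => (ρ, x n)) (b := Filter.atTop) ?_
      (Filter.Eventually.of_forall hx)
    exact tendsto_const_nhds.prodMk_nhds (squeeze_zero hx0 (fun n => (hx1 n).le)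
      tendsto_one_div_add_atTop_nhds_zero_nat)
  obtain ⟨ι, _, z, w, hz, -, hw, hw1, hsum⟩ := eq_pos_convex_span_of_mem_convexHull hmem
  have hz' : ∀ i, ∃ ψ, IsUnitVec ψ ∧ G ψ = z i := fun i => hz ⟨i, rfl⟩
  choose ψ hψ hψz using hz'
  have h1 : ρ = ∑ i, (w i : ℂ) • ketbra (ψ i) := by
    have := congrArg Prod.fst hsum
    rw [Prod.fst_sum] at this
    refine this.symm.trans (Finset.sum_congr rfl fun i _ => ?_)
    rw [← hψz i]
    rfl
  have h2 : ∑ i, w i * minorSq (ψ i) = 0 := by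
    have := congrArg Prod.snd hsum
    rw [Prod.snd_sum] at this
    refine (Finset.sum_congr rfl fun i _ => ?_).trans this
    rw [← hψz i]
    rfl
  have h3 : ∀ i, ∃ σ τ, IsDensity σ ∧ IsDensity τ ∧ ketbra (ψ i) = σ ⊗ₖ τ := fun i => by
    have h4 := (Finset.sum_eq_zero_iff_of_nonneg fun i _ => mul_nonneg (hw i).le
      (minorSq_nonneg _)).1 h2 i (Finset.mem_univ i)
    obtain ⟨x, y, hxy⟩ := exists_eq_prodVec ((mul_eq_zero.1 h4).resolve_left (hw i).ne')
    rw [hxy]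
    exact exists_density_kronecker (hxy ▸ hψ i)
  choose σ τ hσ hτ hk using h3
  have g := (Fintype.equivFin ι).symm
  refine ⟨Fintype.card ι, w ∘ g, σ ∘ g, τ ∘ g, fun i => (hw _).le,
    (Equiv.sum_comp g w).trans hw1, fun i => hσ _, fun i => hτ _, ?_⟩
  rw [h1]
  simp only [hk]
  exact (Equiv.sum_comp g fun i => (w i : ℂ) • (σ i ⊗ₖ τ i)).symm

end Ensembles

end

end Entanglement

theorem theorem1 (d : ℕ) (hd : 2 ≤ d) (q : ℝ) (hq : 2 ≤ q) :
    (∀ ρ : Matrix (Fin d × Fin d) (Fin d × Fin d) ℂ, Entanglement.IsDensity ρ →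
      (Entanglement.ensembleAverages q ρ).Nonempty ∧
        BddBelow (Entanglement.ensembleAverages q ρ)) ∧
    (∀ ψ : Fin d × Fin d → ℂ, Entanglement.IsUnitVec ψ →
      Entanglement.concurrence q (Entanglement.ketbra ψ) =
        Entanglement.pureConcurrence q ψ) ∧
    Entanglement.IsEntanglementMeasure (d := d) (Entanglement.concurrence q) := by
  refine ⟨fun ρ hρ => ⟨Entanglement.ensembleAverages_nonempty hd hρ,
    Entanglement.bddBelow_ensembleAverages hd hq ρ⟩,
    fun ψ hψ => Entanglement.concurrence_ketbra hd hψ, ?_⟩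
  exact
    { nonneg := fun ρ _ => Entanglement.concurrence_nonneg hd hq ρ
      eq_zero_iff := fun ρ hρ =>
        ⟨Entanglement.isSeparable_of_concurrence_eq_zero hd hq hρ,
          Entanglement.concurrence_eq_zero_of_isSeparable hd hq hρ⟩
      local_unitary := fun ρ hρ U hU V hV =>
        Entanglement.concurrence_local_unitary hd hq hρ hU hV
      average_kraus := fun ρ hρ ι _ A hA =>
        Entanglement.sum_trace_mul_concurrence_le hd hq hρ hA id
          (M := fun i => A i * ρ * (A i)ᴴ) fun k => by
          symm
          refine Finset.sum_eq_single_of_mem k ?_ fun i hi hne => ?_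
          · simp
          · exact absurd (by simpa using hi) hne
      average_instrument := by
        rintro ρ hρ κ _ M ⟨ι, _, A, f, hA, hM⟩
        exact Entanglement.sum_trace_mul_concurrence_le hd hq hρ hA f fun k => hM k ρ
      convex := fun n p ρ hp hp1 hρ => Entanglement.concurrence_convex hd hq p ρ hp hp1 hρ
      locc_map := fun ρ hρ Λ hΛ => Entanglement.concurrence_locc_le hd hq hΛ hρ }
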